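/- Let $\mathcal C\subset[0,1]$ be the ternary Cantor set, let $\mathcal C^d=\{(x_1,\dots,x_d)\in\mathbb R^d : x_i\in\mathcal C \text{ for all } i\}$, and let $s_d=d\log_3 2$. Let $\mathcal H^s$ denote the $s$-dimensional Hausdorff measure on $\mathbb R^d$ with the Euclidean metric, normalised as $$\mathcal H^s(F)=\lim_{\delta\to0}\inf\Big\{\sum_{i=1}^\infty|U_i|^s : |U_i|\le\delta \text{ for all } i,\ F\subset\bigcup_{i=1}^\infty U_i\Big\},$$ where $|U|$ is the diameter of $U$. Then $$\mathcal H^{s_3}(\mathcal C^3) > \left(\frac{2\sqrt{26}}{9}\right)^{3\log_3 2} \ge 1.266862 .$$ Moreover $$\mathcal H^{s_3}(\mathcal C^3) > 1.811621 \qquad\text{and}\qquad \mathcal H^{s_3}(\mathcal C^3) > \mathcal H^{s_2}(\mathcal C^2).$$ -/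

import Mathlib

/-- The `d`-fold product of the ternary Cantor set, as a subset of Euclidean space `ℝᵈ`
(with the Euclidean metric, which is the one used for diameters). -/
def cantorProduct (d : ℕ) : Set (EuclideanSpace ℝ (Fin d)) :=
  {x | ∀ i, x i ∈ cantorSet}

/-- The exponent `d * log₃ 2`. -/
noncomputable def cantorExponent (d : ℕ) : ℝ := (d : ℝ) * Real.logb 3 2

/-! The three-dimensional bounds follow from the mass distribution principle with constant 1.812: if
`μ` is the natural probability measure on the cube of the Cantor set and `s = cantorExponent 3`,
then `1.812 * μ U ≤ diam U ^ s` for every bounded `U` (`cantorMeasure_le_diam_rpow`). Since `3 ^ s =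
8`, both sides scale alike under the eight corner similarities, so `U` can be enlarged until it
charges two corner cubes or its diameter bound reaches 1.4, where `μ U ≤ 1` suffices. In the
remaining range 1/3 ≤ d ≤ 1.4, Cauchy–Schwarz forces points of two parts of `U` towards each other
(`cornerSum_add_cornerSum_ge`). Following four ternary digits bounds the joint mass of the two parts
(`cornerPart_measure_add_le`), and these pair bounds are combined over the cube graph
(`sum_corner_le` and its two variants). Twelve intervals of `d` with kernel-checked certificates
finish the estimate (`sum_cornerPart_le_rpow`). The planar measure is at most `2 ^ logb 3 2 ≤ 1.6`
by the standard covers, and the closed form is at most 1.3; both lie below 1.812. -/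

open MeasureTheory ProbabilityTheory

/-! ### The self-similar measure on the cube of the Cantor set. -/

/-- The alphabet of the address space of the cube of the Cantor set. -/
abbrev Corner : Type := Fin 3 → Bool

/-- The uniform probability measure on the eight corners. -/
noncomputable def cornerMeasure : Measure Corner := uniformOn Set.univ

instance : IsProbabilityMeasure cornerMeasure :=
  isProbabilityMeasure_uniformOn Set.finite_univ Set.univ_nonempty

theorem cornerMeasure_apply (s : Set Corner) :
    cornerMeasure s = ∑ b : Corner, (8 : ENNReal)⁻¹ * s.indicator 1 b := by
  classical
  have h : ∀ b : Corner, cornerMeasure {b} = (8 : ENNReal)⁻¹ := by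
    intro b
    rw [cornerMeasure, uniformOn_univ, Measure.count_singleton]
    simp
  have h2 := sum_measure_singleton (s := Finset.univ.filter (· ∈ s)) (μ := cornerMeasure)
  have h3 : ((Finset.univ.filter (· ∈ s) : Finset Corner) : Set Corner) = s := by
    ext b; simp
  rw [h3] at h2
  rw [← h2, Finset.sum_filter]
  refine Finset.sum_congr rfl fun b _ => ?_
  by_cases hb : b ∈ s <;> simp [hb, h]

/-- Fair coin tossing measure on the addresses. -/
noncomputable def addressMeasure : Measure (ℕ → Corner) :=
  Measure.infinitePi fun _ => cornerMeasure

instance : IsProbabilityMeasure addressMeasure := by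
  unfold addressMeasure; infer_instance

/-- Prefixing an address by a letter. -/
def prefixAddress (b : Corner) (ω : ℕ → Corner) : ℕ → Corner := fun n => Nat.casesOn n b ω

theorem measurable_prefixAddress (b : Corner) : Measurable (prefixAddress b) := by
  refine measurable_pi_lambda _ fun n => ?_
  cases n with
  | zero => exact measurable_const
  | succ n => exact measurable_pi_apply n

/-- A product measure is determined by its values on boxes; there, conditioning on the first letter
leaves the box with indices shifted by one. -/
theorem addressMeasure_eq_sum :
    addressMeasure = ∑ b : Corner, (8 : ENNReal)⁻¹ • addressMeasure.map (prefixAddress b) := by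
  classical
  symm
  refine Measure.eq_infinitePi (μ := fun _ : ℕ => cornerMeasure) (fun s t ht => ?_)
  set s' : Finset ℕ := s.preimage Nat.succ Nat.succ_injective.injOn with hs'
  have key : ∀ b : Corner, addressMeasure.map (prefixAddress b) (Set.pi s t) =
      (if 0 ∈ s then (t 0).indicator 1 b else 1) * ∏ i ∈ s', cornerMeasure (t (i + 1)) := by
    intro b
    rw [Measure.map_apply (measurable_prefixAddress b)
      (MeasurableSet.pi s.countable_toSet fun i _ => ht i)]
    have h1 : addressMeasure (Set.pi s' fun i => t (i + 1)) =
        ∏ i ∈ s', cornerMeasure (t (i + 1)) :=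
      Measure.infinitePi_pi _ fun i _ => ht (i + 1)
    have h2 : prefixAddress b ⁻¹' Set.pi s t =
        {ω | (0 ∈ s → b ∈ t 0)} ∩ Set.pi s' fun i => t (i + 1) := by
      ext ω
      simp only [Set.mem_preimage, Set.mem_pi, Set.mem_inter_iff, Set.mem_ofPred_eq, hs',
        Finset.coe_preimage, Finset.mem_coe]
      constructor
      · intro h
        exact ⟨fun h0 => h 0 h0, fun i hi => h (i + 1) hi⟩
      · rintro ⟨h0, h⟩ i hi
        cases i with
        | zero => exact h0 hi
        | succ i => exact h i hi
    rw [h2]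
    by_cases h0 : 0 ∈ s
    · by_cases hb : b ∈ t 0
      · simp [h0, hb, h1]
      · simp [h0, hb]
    · simp [h0, h1]
  simp only [Measure.coe_finsetSum, Finset.sum_apply, Measure.smul_apply, smul_eq_mul, key]
  simp_rw [← mul_assoc]
  rw [← Finset.sum_mul]
  have h3 : ∑ b : Corner, (8 : ENNReal)⁻¹ * (if 0 ∈ s then (t 0).indicator 1 b else 1) =
      if 0 ∈ s then cornerMeasure (t 0) else 1 := by
    split_ifs
    · rw [cornerMeasure_apply]
    · have := cornerMeasure_apply Set.univ
      simpa using this.symm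
  rw [h3]
  have h4 : s.erase 0 = s'.map ⟨Nat.succ, Nat.succ_injective⟩ := by
    ext i
    cases i with
    | zero => simp
    | succ i => simp [hs']
  split_ifs with h0
  · rw [← Finset.mul_prod_erase s _ h0, h4, Finset.prod_map]
    simp
  · rw [← Finset.erase_eq_of_notMem h0, h4, Finset.prod_map]
    simp

/-- The point of the cube of the Cantor set with a given address. -/
noncomputable def addressPoint (ω : ℕ → Corner) : EuclideanSpace ℝ (Fin 3) :=
  WithLp.toLp 2 fun l => Real.ofDigits fun n => cond (ω n l) (2 : Fin 3) 0

/-- The similarity of ratio `1 / 3` which maps the unit cube to the cube at the corner `b`. -/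
noncomputable def cornerMap (b : Corner) (x : EuclideanSpace ℝ (Fin 3)) :
    EuclideanSpace ℝ (Fin 3) :=
  WithLp.toLp 2 fun l => ((if b l then 2 else 0) + x l) / 3

@[simp] theorem cornerMap_apply (b : Corner) (x : EuclideanSpace ℝ (Fin 3)) (l : Fin 3) :
    cornerMap b x l = ((if b l then 2 else 0) + x l) / 3 := rfl

theorem continuous_cornerMap (b : Corner) : Continuous (cornerMap b) := by
  unfold cornerMap
  fun_prop

theorem measurable_addressPoint : Measurable addressPoint := by
  have h : Measurable fun ω : ℕ → Corner => fun l : Fin 3 =>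
      Real.ofDigits fun n => cond (ω n l) (2 : Fin 3) 0 := by
    refine measurable_pi_lambda _ fun l => ?_
    refine Real.continuous_ofDigits.measurable.comp (measurable_pi_lambda _ fun n => ?_)
    exact (measurable_of_finite fun c : Corner => cond (c l) (2 : Fin 3) 0).comp
      (measurable_pi_apply n)
  exact (MeasurableEquiv.toLp 2 (Fin 3 → ℝ)).measurable.comp h

theorem addressPoint_prefixAddress (b : Corner) (ω : ℕ → Corner) :
    addressPoint (prefixAddress b ω) = cornerMap b (addressPoint ω) := by
  ext l
  simp only [addressPoint, cornerMap_apply]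
  rw [Real.ofDigits_eq_sum_add_ofDigits _ 1]
  cases h : b l <;> simp [Real.ofDigitsTerm, prefixAddress, h] <;> ring

/-- The natural probability measure on the cube of the Cantor set. -/
noncomputable def cantorMeasure : Measure (EuclideanSpace ℝ (Fin 3)) :=
  addressMeasure.map addressPoint

instance : IsProbabilityMeasure cantorMeasure :=
  Measure.isProbabilityMeasure_map measurable_addressPoint.aemeasurable

theorem cantorMeasure_apply_eq_sum {U : Set (EuclideanSpace ℝ (Fin 3))} (hU : MeasurableSet U) :
    cantorMeasure U = ∑ b : Corner, (8 : ENNReal)⁻¹ * cantorMeasure (cornerMap b ⁻¹' U) := by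
  have h : ∀ b : Corner, cantorMeasure (cornerMap b ⁻¹' U) =
      addressMeasure.map (prefixAddress b) (addressPoint ⁻¹' U) := by
    intro b
    rw [cantorMeasure, Measure.map_apply measurable_addressPoint
      ((continuous_cornerMap b).measurable hU), Measure.map_apply (measurable_prefixAddress b)
      (measurable_addressPoint hU)]
    congr 1
    ext ω
    simp [addressPoint_prefixAddress]
  simp_rw [h]
  rw [cantorMeasure, Measure.map_apply measurable_addressPoint hU]
  conv_lhs => rw [addressMeasure_eq_sum]
  simp

theorem cantorMeasure_real_eq_sum {U : Set (EuclideanSpace ℝ (Fin 3))} (hU : MeasurableSet U) :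
    cantorMeasure.real U = 1 / 8 * ∑ b : Corner, cantorMeasure.real (cornerMap b ⁻¹' U) := by
  rw [measureReal_def, cantorMeasure_apply_eq_sum hU, ENNReal.toReal_sum]
  · simp [measureReal_def, Finset.mul_sum]
  · intro b _
    exact ENNReal.mul_ne_top (by simp) (measure_ne_top _ _)

theorem cantorMeasure_cantorProduct : cantorMeasure (cantorProduct 3) = 1 := by
  have hm : MeasurableSet (cantorProduct 3) := by
    have : cantorProduct 3 = ⋂ i, (fun x : EuclideanSpace ℝ (Fin 3) => x i) ⁻¹' cantorSet := by
      ext x; simp [cantorProduct]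
    rw [this]
    exact MeasurableSet.iInter fun i =>
      (isClosed_cantorSet.preimage (by fun_prop)).measurableSet
  rw [cantorMeasure, Measure.map_apply measurable_addressPoint hm]
  have : addressPoint ⁻¹' cantorProduct 3 = Set.univ := by
    ext ω
    simp only [Set.mem_preimage, Set.mem_univ, iff_true]
    intro i
    exact ofDigits_bool_to_fin_three_mem_cantorSet fun n => ω n i
  rw [this, measure_univ]

/-- The closed unit cube. -/
def unitCube : Set (EuclideanSpace ℝ (Fin 3)) := {x | ∀ l, x l ∈ Set.Icc (0 : ℝ) 1}

theorem isClosed_unitCube : IsClosed unitCube := by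
  have : unitCube = ⋂ i, (fun x : EuclideanSpace ℝ (Fin 3) => x i) ⁻¹' Set.Icc (0 : ℝ) 1 := by
    ext x; simp [unitCube]
  rw [this]
  exact isClosed_iInter fun i => isClosed_Icc.preimage (by fun_prop)

theorem cantorMeasure_inter_unitCube (U : Set (EuclideanSpace ℝ (Fin 3))) :
    cantorMeasure (U ∩ unitCube) = cantorMeasure U := by
  have h : cantorMeasure unitCubeᶜ = 0 := by
    rw [prob_compl_eq_zero_iff isClosed_unitCube.measurableSet]
    refine le_antisymm prob_le_one ?_
    rw [← cantorMeasure_cantorProduct]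
    exact measure_mono fun x hx l => cantorSet_subset_unitInterval (hx l)
  exact measure_inter_conull h

/-! ### Tail bounds for sums of coordinates. -/

/-- The set of coordinates in which two corners differ. -/
def differing (b b' : Corner) : Finset (Fin 3) := Finset.univ.filter fun l => b l ≠ b' l

/-- The sum over the coordinates in `D` of the distance of `x` to the facets through the
corner `b` of the unit cube. -/
noncomputable def cornerSum (D : Finset (Fin 3)) (b : Corner) (x : EuclideanSpace ℝ (Fin 3)) : ℝ :=
  ∑ l ∈ D, if b l then 1 - x l else x l

theorem continuous_cornerSum (D : Finset (Fin 3)) (b : Corner) : Continuous (cornerSum D b) := by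
  unfold cornerSum
  refine continuous_finsetSum _ fun l _ => ?_
  split_ifs <;> fun_prop

theorem cornerSum_nonneg (D : Finset (Fin 3)) (b : Corner) {x : EuclideanSpace ℝ (Fin 3)}
    (hx : x ∈ unitCube) : 0 ≤ cornerSum D b x := by
  refine Finset.sum_nonneg fun l _ => ?_
  have := hx l
  split_ifs <;> linarith [this.1, this.2]

theorem cornerSum_le (D : Finset (Fin 3)) (b : Corner) {x : EuclideanSpace ℝ (Fin 3)}
    (hx : x ∈ unitCube) : cornerSum D b x ≤ D.card := by
  have : cornerSum D b x ≤ ∑ l ∈ D, (1 : ℝ) := by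
    refine Finset.sum_le_sum fun l _ => ?_
    have := hx l
    split_ifs <;> linarith [this.1, this.2]
  simpa using this

theorem cornerSum_cornerMap (D : Finset (Fin 3)) (b b' : Corner) (x : EuclideanSpace ℝ (Fin 3)) :
    cornerSum D b (cornerMap b' x) =
      (2 * ((D.filter fun l => b' l ≠ b l).card : ℝ) + cornerSum D b x) / 3 := by
  rw [Finset.card_filter]
  push_cast
  rw [cornerSum, cornerSum, Finset.mul_sum, ← Finset.sum_add_distrib, Finset.sum_div]
  refine Finset.sum_congr rfl fun l _ => ?_
  rw [cornerMap_apply]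
  cases b l <;> cases b' l <;> simp <;> ring

/-- An upper bound, in units of `2 ^ (-k n)`, for the probability that the sum of `k` independent
points of the Cantor set is at least `x / q`: the recursion follows the first `n` ternary digits. -/
def tailBound (k q : ℕ) : ℕ → ℤ → ℕ
  | 0, x => if x ≤ 0 then 1 else if x ≤ k * q then 1 else 0
  | n + 1, x => if x ≤ 0 then 2 ^ (k * (n + 1)) else if x ≤ k * q then
      ∑ j ∈ Finset.range (k + 1), k.choose j * tailBound k q n (3 * x - 2 * q * j) else 0

theorem card_filter_differing (D : Finset (Fin 3)) (b : Corner) (j : ℕ) (hj : j ≤ 3):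
    (Finset.univ.filter fun b' : Corner => (D.filter fun l => b' l ≠ b l).card = j).card =
      2 ^ (3 - D.card) * D.card.choose j := by
  interval_cases j <;> revert D b <;> decide +kernel

theorem sum_card_differing (D : Finset (Fin 3)) (b : Corner) (f : ℕ → ℝ) :
    ∑ b' : Corner, f (D.filter fun l => b' l ≠ b l).card =
      2 ^ (3 - D.card) * ∑ j ∈ Finset.range (D.card + 1), D.card.choose j * f j := by
  have hD : D.card ≤ 3 := by simpa using Finset.card_le_univ D
  rw [← Finset.sum_fiberwise_of_maps_to (s := Finset.univ) (t := Finset.range (D.card + 1))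
    (g := fun b' : Corner => (D.filter fun l => b' l ≠ b l).card), Finset.mul_sum]
  · refine Finset.sum_congr rfl fun j hj => ?_
    rw [Finset.sum_congr rfl (g := fun _ => f j)]
    · rw [Finset.sum_const, card_filter_differing _ _ _ (by simp at hj; omega)]
      simp; ring
    · intro b' hb'
      rw [(Finset.mem_filter.1 hb').2]
  · intro b' _
    simpa [Nat.lt_succ_iff] using Finset.card_filter_le D _

/-- One step of self-similarity: if `j` first digits on `D` disagree with `b`, the sum `S` becomes
`(2 * j + S) / 3`, so the threshold `x` becomes `3 * x - 2 * q * j`; `j` is binomially distributed.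
-/
theorem cantorMeasure_cornerSum_le {q : ℕ} (hq : 0 < q) (D : Finset (Fin 3)) (b : Corner) (n : ℕ) :
    ∀ x : ℤ, cantorMeasure.real ({y | (x : ℝ) / q ≤ cornerSum D b y}) ≤
      tailBound D.card q n x / 2 ^ (D.card * n) := by
  have hq' : (0 : ℝ) < q := by exact_mod_cast hq
  have hzero : ∀ x : ℤ, (D.card : ℤ) * q < x →
      cantorMeasure.real {y | (x : ℝ) / q ≤ cornerSum D b y} = 0 := by
    intro x hx
    rw [measureReal_def, ← cantorMeasure_inter_unitCube]
    convert ENNReal.toReal_zero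
    convert measure_empty (μ := cantorMeasure)
    ext y
    simp only [Set.mem_inter_iff, Set.mem_ofPred_eq, Set.mem_empty_iff_false, iff_false, not_and]
    intro h hy
    have h1 := cornerSum_le D b hy
    have h2 : (D.card : ℝ) * q < x := by exact_mod_cast hx
    rw [div_le_iff₀ hq'] at h
    nlinarith
  induction n with
  | zero =>
    intro x
    simp only [tailBound]
    split_ifs with h1 h2
    · simp
    · simp
    · simp [hzero x (by omega)]
  | succ n ih =>
    intro x
    simp only [tailBound]
    split_ifs with h1 h2
    · simp
    · have hm : MeasurableSet {y | (x : ℝ) / q ≤ cornerSum D b y} :=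
        (isClosed_le continuous_const (continuous_cornerSum D b)).measurableSet
      rw [cantorMeasure_real_eq_sum hm]
      have h3 : ∀ b' : Corner, cornerMap b' ⁻¹' {y | (x : ℝ) / q ≤ cornerSum D b y} =
          {y | ((3 * x - 2 * q * (D.filter fun l => b' l ≠ b l).card : ℤ) : ℝ) / q ≤
            cornerSum D b y} := by
        intro b'
        ext y
        simp only [Set.mem_preimage, Set.mem_ofPred_eq, cornerSum_cornerMap]
        push_cast
        rw [div_le_div_iff₀ hq' (by norm_num), div_le_iff₀ hq']
        constructor <;> intro h <;> nlinarith
      simp_rw [h3]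
      have hD : D.card ≤ 3 := by simpa using Finset.card_le_univ D
      have h4 : (8 : ℝ) = 2 ^ (3 - D.card) * 2 ^ D.card := by
        rw [← pow_add, Nat.sub_add_cancel hD]; norm_num
      calc _ ≤ 1 / 8 * ∑ b' : Corner,
            (tailBound D.card q n (3 * x - 2 * q * (D.filter fun l => b' l ≠ b l).card) : ℝ) /
              2 ^ (D.card * n) := by
            gcongr with b' _
            exact ih _
        _ = _ := by
            rw [sum_card_differing D b fun j =>
              (tailBound D.card q n (3 * x - 2 * q * j) : ℝ) / 2 ^ (D.card * n), h4]
            push_cast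
            rw [mul_add, pow_add]
            simp_rw [mul_div_assoc', ← Finset.sum_div]
            field_simp
            rw [mul_one, mul_comm]
    · simp [hzero x (by omega)]

/-! ### Masses of two parts of a set of bounded diameter. -/

/-- In a differing coordinate the distance is `(3 - u - v) / 3`, with `u` and `v` the terms of the
two corner sums. Cauchy–Schwarz bounds the sum of these distances by `√k * d`. -/
theorem cornerSum_add_cornerSum_ge {b b' : Corner} {x y : EuclideanSpace ℝ (Fin 3)} {d : ℝ}
    (hx : x ∈ unitCube) (hy : y ∈ unitCube) (h : dist (cornerMap b x) (cornerMap b' y) ≤ d) :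
    3 * ((differing b b').card : ℝ) - 3 * Real.sqrt (differing b b').card * d ≤
      cornerSum (differing b b') b x + cornerSum (differing b b') b' y := by
  set D := differing b b' with hD
  set z : Fin 3 → ℝ := fun l => |cornerMap b x l - cornerMap b' y l| with hz
  have h1 : ∀ l ∈ D, z l =
      (3 - (if b l then 1 - x l else x l) - (if b' l then 1 - y l else y l)) / 3 := by
    intro l hl
    have hl' : b l ≠ b' l := by simpa [hD, differing] using hl
    have h1 := hx l
    have h2 := hy l
    rw [Set.mem_Icc] at h1 h2
    simp only [hz, cornerMap_apply]
    rcases hb : b l with _ | _ <;> rcases hb' : b' l with _ | _ <;> simp_all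
    · rw [abs_of_nonpos (by linarith)]; ring
    · rw [abs_of_nonneg (by linarith)]; ring
  have h2 : ∑ l ∈ D, z l = ((3 : ℝ) * D.card - cornerSum D b x - cornerSum D b' y) / 3 := by
    rw [Finset.sum_congr rfl h1, ← Finset.sum_div, Finset.sum_sub_distrib, Finset.sum_sub_distrib]
    simp [cornerSum]; ring
  have h3 : ∑ l ∈ D, z l ^ 2 ≤ d ^ 2 := by
    have : ∑ l, z l ^ 2 = dist (cornerMap b x) (cornerMap b' y) ^ 2 := by
      rw [EuclideanSpace.dist_eq, Real.sq_sqrt (by positivity)]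
      simp [hz, Real.dist_eq]
    refine le_trans (Finset.sum_le_univ_sum_of_nonneg fun l => sq_nonneg _) ?_
    rw [this]
    gcongr
  have hd : 0 ≤ d := dist_nonneg.trans h
  have h4 : ∑ l ∈ D, z l ≤ Real.sqrt D.card * d := by
    refine abs_le_of_sq_le_sq' ?_ (by positivity) |>.2
    rw [mul_pow, Real.sq_sqrt (by positivity)]
    exact (sq_sum_le_card_mul_sum_sq).trans (by gcongr)
  linarith

/-- The part of `U` in the cube at the corner `b`, rescaled to the unit cube. -/
def cornerPart (U : Set (EuclideanSpace ℝ (Fin 3))) (b : Corner) :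
    Set (EuclideanSpace ℝ (Fin 3)) := cornerMap b ⁻¹' U ∩ unitCube

theorem cornerPart_measure_le {q : ℕ} (hq : 0 < q) (n : ℕ) {U : Set (EuclideanSpace ℝ (Fin 3))}
    {D : Finset (Fin 3)} {b : Corner} {x : ℤ}
    (h : ∀ y ∈ cornerPart U b, (x : ℝ) / q ≤ cornerSum D b y) :
    cantorMeasure.real (cornerPart U b) ≤ tailBound D.card q n x / 2 ^ (D.card * n) :=
  (measureReal_mono h).trans (cantorMeasure_cornerSum_le hq D b n x)

/-- A single point of the other part suffices: its corner sum is at most `k`, which costs `k * q` in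
the threshold. -/
theorem cornerPart_measure_le_of_ne_zero {q : ℕ} (hq : 0 < q) (n : ℕ)
    {U : Set (EuclideanSpace ℝ (Fin 3))} {d : ℝ}
    (hU : ∀ x ∈ U, ∀ y ∈ U, dist x y ≤ d) {b b' : Corner} {k : ℕ} (hk : (differing b b').card = k)
    {t : ℤ} (ht : (t : ℝ) / q ≤ 3 * k - 3 * Real.sqrt k * d)
    (hb' : cantorMeasure.real (cornerPart U b') ≠ 0) :
    cantorMeasure.real (cornerPart U b) ≤ tailBound k q n (t - k * q) / 2 ^ (k * n) := by
  subst hk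
  have hq' : (0 : ℝ) < q := by exact_mod_cast hq
  obtain ⟨y, hy⟩ : (cornerPart U b').Nonempty := by
    by_contra h
    rw [Set.not_nonempty_iff_eq_empty] at h
    simp [h] at hb'
  refine cornerPart_measure_le hq n fun x hx => ?_
  have h1 := cornerSum_add_cornerSum_ge hx.2 hy.2 (hU _ hx.1 _ hy.1)
  have h2 := cornerSum_le (differing b b') b' hy.2
  push_cast
  rw [sub_div, mul_div_assoc, div_self hq'.ne']
  linarith

theorem cornerPart_measure_add_le {q : ℕ} (hq : 0 < q) (n : ℕ)
    {U : Set (EuclideanSpace ℝ (Fin 3))} {d : ℝ}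
    (hU : ∀ x ∈ U, ∀ y ∈ U, dist x y ≤ d) {b b' : Corner} {k : ℕ} (hk : (differing b b').card = k)
    {t : ℤ} (ht : (t : ℝ) / q ≤ 3 * k - 3 * Real.sqrt k * d) {F : ℕ}
    (hF : ∀ j ∈ Finset.range (k * q + 1), t - 1 - j < k * q →
      tailBound k q n j + tailBound k q n (t - 1 - j) ≤ F)
    (hb : cantorMeasure.real (cornerPart U b) ≠ 0)
    (hb' : cantorMeasure.real (cornerPart U b') ≠ 0) :
    cantorMeasure.real (cornerPart U b) + cantorMeasure.real (cornerPart U b') ≤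
      F / 2 ^ (k * n) := by
  subst hk
  set D := differing b b' with hD
  have hq' : (0 : ℝ) < q := by exact_mod_cast hq
  have hne : ∀ c, cantorMeasure.real (cornerPart U c) ≠ 0 → (cornerPart U c).Nonempty := by
    intro c hc
    by_contra h
    rw [Set.not_nonempty_iff_eq_empty] at h
    simp [h] at hc
  obtain ⟨x₀, hx₀⟩ := hne b hb
  obtain ⟨y₀, hy₀⟩ := hne b' hb'
  -- `j / q` is the infimum of the corner sum on the first part, rounded down to the grid. Some
  -- point lies below `(j + 1) / q`, whence the loss of 1 in `t - 1 - j`.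
  obtain ⟨j, hj, hj'⟩ := Int.exists_greatest_of_bdd
    (P := fun j : ℤ => ∀ x ∈ cornerPart U b, (j : ℝ) / q ≤ cornerSum D b x)
    ⟨D.card * q, fun z hz => by
      have h1 := (hz x₀ hx₀).trans (cornerSum_le D b hx₀.2)
      rw [div_le_iff₀ hq'] at h1
      exact_mod_cast h1⟩ ⟨0, fun x hx => by simpa using cornerSum_nonneg D b hx.2⟩
  have hj0 : 0 ≤ j := hj' 0 fun x hx => by simpa using cornerSum_nonneg D b hx.2
  have hjk : j ≤ D.card * q := by
    have h1 := (hj x₀ hx₀).trans (cornerSum_le D b hx₀.2)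
    rw [div_le_iff₀ hq'] at h1
    exact_mod_cast h1
  obtain ⟨x, hx, hxj⟩ : ∃ x ∈ cornerPart U b, cornerSum D b x < ((j + 1 : ℤ) : ℝ) / q := by
    by_contra! h
    have := hj' (j + 1) h
    omega
  have hy : ∀ y ∈ cornerPart U b', ((t - 1 - j : ℤ) : ℝ) / q < cornerSum D b' y := by
    intro y hy
    have h1 := cornerSum_add_cornerSum_ge hx.2 hy.2 (hU _ hx.1 _ hy.1)
    have h2 : ((t - 1 - j : ℤ) : ℝ) / q = t / q - ((j + 1 : ℤ) : ℝ) / q := by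
      rw [← sub_div]; push_cast; ring
    rw [h2]
    linarith
  have hlt : t - 1 - j < D.card * q := by
    have h1 := (hy y₀ hy₀).trans_le (cornerSum_le D b' hy₀.2)
    rw [div_lt_iff₀ hq'] at h1
    exact_mod_cast h1
  lift j to ℕ using hj0
  have h1 := hF j (by rw [Finset.mem_range]; have : j ≤ D.card * q := by exact_mod_cast hjk
                      omega) hlt
  have h2 := cornerPart_measure_le hq n hj
  have h3 := cornerPart_measure_le hq n fun y h => (hy y h).le
  have h4 : (tailBound D.card q n j : ℝ) + tailBound D.card q n (t - 1 - j) ≤ F := by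
    exact_mod_cast h1
  refine (add_le_add h2 h3).trans ?_
  rw [← add_div]
  gcongr

theorem cantorMeasure_real_eq_sum_cornerPart {U : Set (EuclideanSpace ℝ (Fin 3))}
    (hU : MeasurableSet U) :
    cantorMeasure.real U = 1 / 8 * ∑ b : Corner, cantorMeasure.real (cornerPart U b) := by
  simp_rw [cantorMeasure_real_eq_sum hU, measureReal_def, cornerPart, cantorMeasure_inter_unitCube]

/-! ### Combining pair bounds over the eight corners. -/

-- `e` and `o` are the two parity classes, with `oᵢ` antipodal to `eᵢ`. Within a class averaging
-- gives `3 / 2 * f₂` for three terms and `2 * f₂` for four. By support: eight terms use `b6`, seven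
-- `b7`, six `b5`, four plus one `b4`, three plus one `b3`; the smaller supports follow likewise.
set_option maxHeartbeats 2000000 in
theorem sum_le_of_pairwise {B f₁ f₂ f₃ g : ℝ} {e₁ e₂ e₃ e₄ o₁ o₂ o₃ o₄ : ℝ}
    (b1 : f₁ ≤ B) (b2 : f₃ ≤ B) (b3 : g + 3 / 2 * f₂ ≤ B)
    (b4 : f₃ + 3 / 2 * f₂ ≤ B) (b5 : 3 * f₂ ≤ B) (b6 : 4 * f₃ ≤ B) (b7 : 3 * f₃ + 1 ≤ B)
    (p₂ : 0 ≤ f₂) (p₃ : 0 ≤ f₃)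
    (h1 : e₁ ≤ 1) (h2 : e₂ ≤ 1) (h3 : e₃ ≤ 1) (h4 : e₄ ≤ 1)
    (k1 : o₁ ≤ 1) (k2 : o₂ ≤ 1) (k3 : o₃ ≤ 1) (k4 : o₄ ≤ 1)
    (e12 : e₁ ≠ 0 → e₂ ≠ 0 → e₁ + e₂ ≤ f₂) (e13 : e₁ ≠ 0 → e₃ ≠ 0 → e₁ + e₃ ≤ f₂)
    (e14 : e₁ ≠ 0 → e₄ ≠ 0 → e₁ + e₄ ≤ f₂) (e23 : e₂ ≠ 0 → e₃ ≠ 0 → e₂ + e₃ ≤ f₂)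
    (e24 : e₂ ≠ 0 → e₄ ≠ 0 → e₂ + e₄ ≤ f₂) (e34 : e₃ ≠ 0 → e₄ ≠ 0 → e₃ + e₄ ≤ f₂)
    (o12 : o₁ ≠ 0 → o₂ ≠ 0 → o₁ + o₂ ≤ f₂) (o13 : o₁ ≠ 0 → o₃ ≠ 0 → o₁ + o₃ ≤ f₂)
    (o14 : o₁ ≠ 0 → o₄ ≠ 0 → o₁ + o₄ ≤ f₂) (o23 : o₂ ≠ 0 → o₃ ≠ 0 → o₂ + o₃ ≤ f₂)
    (o24 : o₂ ≠ 0 → o₄ ≠ 0 → o₂ + o₄ ≤ f₂) (o34 : o₃ ≠ 0 → o₄ ≠ 0 → o₃ + o₄ ≤ f₂)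
    (d1 : e₁ ≠ 0 → o₁ ≠ 0 → e₁ + o₁ ≤ f₃) (d2 : e₂ ≠ 0 → o₂ ≠ 0 → e₂ + o₂ ≤ f₃)
    (d3 : e₃ ≠ 0 → o₃ ≠ 0 → e₃ + o₃ ≤ f₃) (d4 : e₄ ≠ 0 → o₄ ≠ 0 → e₄ + o₄ ≤ f₃)
    (a12 : e₁ ≠ 0 → o₂ ≠ 0 → e₁ + o₂ ≤ f₁ ∧ e₁ ≤ g ∧ o₂ ≤ g)
    (a13 : e₁ ≠ 0 → o₃ ≠ 0 → e₁ + o₃ ≤ f₁ ∧ e₁ ≤ g ∧ o₃ ≤ g)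
    (a14 : e₁ ≠ 0 → o₄ ≠ 0 → e₁ + o₄ ≤ f₁ ∧ e₁ ≤ g ∧ o₄ ≤ g)
    (a21 : e₂ ≠ 0 → o₁ ≠ 0 → e₂ + o₁ ≤ f₁ ∧ e₂ ≤ g ∧ o₁ ≤ g)
    (a23 : e₂ ≠ 0 → o₃ ≠ 0 → e₂ + o₃ ≤ f₁ ∧ e₂ ≤ g ∧ o₃ ≤ g)
    (a24 : e₂ ≠ 0 → o₄ ≠ 0 → e₂ + o₄ ≤ f₁ ∧ e₂ ≤ g ∧ o₄ ≤ g)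
    (a31 : e₃ ≠ 0 → o₁ ≠ 0 → e₃ + o₁ ≤ f₁ ∧ e₃ ≤ g ∧ o₁ ≤ g)
    (a32 : e₃ ≠ 0 → o₂ ≠ 0 → e₃ + o₂ ≤ f₁ ∧ e₃ ≤ g ∧ o₂ ≤ g)
    (a34 : e₃ ≠ 0 → o₄ ≠ 0 → e₃ + o₄ ≤ f₁ ∧ e₃ ≤ g ∧ o₄ ≤ g)
    (a41 : e₄ ≠ 0 → o₁ ≠ 0 → e₄ + o₁ ≤ f₁ ∧ e₄ ≤ g ∧ o₁ ≤ g)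
    (a42 : e₄ ≠ 0 → o₂ ≠ 0 → e₄ + o₂ ≤ f₁ ∧ e₄ ≤ g ∧ o₂ ≤ g)
    (a43 : e₄ ≠ 0 → o₃ ≠ 0 → e₄ + o₃ ≤ f₁ ∧ e₄ ≤ g ∧ o₃ ≤ g) :
    e₁ + e₂ + e₃ + e₄ + (o₁ + o₂ + o₃ + o₄) ≤ B := by
  by_cases x1 : e₁ = 0 <;> by_cases x2 : e₂ = 0 <;> by_cases x3 : e₃ = 0 <;>
  by_cases x4 : e₄ = 0 <;> by_cases y1 : o₁ = 0 <;> by_cases y2 : o₂ = 0 <;>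
  by_cases y3 : o₃ = 0 <;> by_cases y4 : o₄ = 0 <;>
  simp only [x1, x2, x3, x4, y1, y2, y3, y4, ne_eq, not_true_eq_false, not_false_eq_true,
    false_imp_iff, true_imp_iff] at e12 e13 e14 e23 e24 e34 o12 o13 o14 o23 o24 o34 d1 d2 d3 d4 a12 a13 a14 a21 a23 a24 a31 a32 a34 a41 a42 a43 ⊢ <;>
  linarith

theorem sum_corner_eq (m : Corner → ℝ) : ∑ b, m b =
    m ![false, false, false] + m ![true, true, false] + m ![true, false, true] +
      m ![false, true, true] + (m ![true, true, true] + m ![false, false, true] +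
      m ![false, true, false] + m ![true, false, false]) := by
  have h : (Finset.univ : Finset Corner) = {![false, false, false], ![true, true, false],
      ![true, false, true], ![false, true, true], ![true, true, true], ![false, false, true],
      ![false, true, false], ![true, false, false]} := by decide
  rw [h]
  repeat rw [Finset.sum_insert (by decide)]
  rw [Finset.sum_singleton]
  ring

theorem sum_corner_le {B f₁ f₂ f₃ g : ℝ}
    (b1 : f₁ ≤ B) (b2 : f₃ ≤ B) (b3 : g + 3 / 2 * f₂ ≤ B)
    (b4 : f₃ + 3 / 2 * f₂ ≤ B) (b5 : 3 * f₂ ≤ B) (b6 : 4 * f₃ ≤ B) (b7 : 3 * f₃ + 1 ≤ B)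
    (p₂ : 0 ≤ f₂) (p₃ : 0 ≤ f₃) {m : Corner → ℝ} (hm : ∀ b, m b ≤ 1)
    (h₁ : ∀ b b', (differing b b').card = 1 → m b ≠ 0 → m b' ≠ 0 →
      m b + m b' ≤ f₁ ∧ m b ≤ g ∧ m b' ≤ g)
    (h₂ : ∀ b b', (differing b b').card = 2 → m b ≠ 0 → m b' ≠ 0 → m b + m b' ≤ f₂)
    (h₃ : ∀ b b', (differing b b').card = 3 → m b ≠ 0 → m b' ≠ 0 → m b + m b' ≤ f₃) :
    ∑ b, m b ≤ B := by
  rw [sum_corner_eq]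
  apply sum_le_of_pairwise b1 b2 b3 b4 b5 b6 b7 p₂ p₃ <;>
  first
  | exact hm _
  | exact h₁ _ _ (by decide)
  | exact h₂ _ _ (by decide)
  | exact h₃ _ _ (by decide)

/-- The four long diagonals partition the corners; `4 ≤ B` covers a diagonal with a vanishing end.
-/
theorem sum_corner_le_of_antipodal {B f₃ : ℝ} (b1 : 4 ≤ B) (b2 : 4 * f₃ ≤ B)
    {m : Corner → ℝ} (hm : ∀ b, m b ≤ 1)
    (h₃ : ∀ b b', (differing b b').card = 3 → m b ≠ 0 → m b' ≠ 0 → m b + m b' ≤ f₃) :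
    ∑ b, m b ≤ B := by
  have h : ∀ b b', (differing b b').card = 3 → m b + m b' ≤ B / 4 := by
    intro b b' hbb'
    by_cases hb : m b = 0
    · linarith [hm b']
    by_cases hb' : m b' = 0
    · linarith [hm b]
    linarith [h₃ b b' hbb' hb hb']
  rw [sum_corner_eq]
  linarith [h ![false, false, false] ![true, true, true] (by decide),
    h ![true, true, false] ![false, false, true] (by decide),
    h ![true, false, true] ![false, true, false] (by decide),
    h ![false, true, true] ![true, false, false] (by decide)]

/-- All charged corners are pairwise adjacent, and the cube graph has no triangles. -/
theorem sum_corner_le_of_adjacent {f₁ : ℝ} {m : Corner → ℝ} (hm : ∀ b, 0 ≤ m b)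
    {a a' : Corner} (haa' : a ≠ a') (ha : m a ≠ 0) (ha' : m a' ≠ 0)
    (h₁ : ∀ b b', (differing b b').card = 1 → m b ≠ 0 → m b' ≠ 0 → m b + m b' ≤ f₁)
    (h₂ : ∀ b b', 2 ≤ (differing b b').card → m b ≠ 0 → m b' ≠ 0 → m b + m b' ≤ 0) :
    ∑ b, m b ≤ f₁ := by
  have hadj : ∀ b b', b ≠ b' → m b ≠ 0 → m b' ≠ 0 → (differing b b').card = 1 := by
    intro b b' hbb' hb hb'
    by_contra h
    have h0 : (differing b b').card ≠ 0 := by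
      revert hbb'; clear * -; revert b b'; decide
    have := h₂ b b' (by omega) hb hb'
    have := (hm b).lt_of_ne' hb
    have := hm b'
    linarith
  have hno : ∀ b b' b'' : Corner, (differing b b').card = 1 → (differing b b'').card = 1 →
      (differing b' b'').card ≠ 1 := by decide +kernel
  have hz : ∀ c, c ≠ a → c ≠ a' → m c = 0 := by
    intro c hca hca'
    by_contra hc
    exact hno c a a' (hadj _ _ hca hc ha) (hadj _ _ hca' hc ha') (hadj _ _ haa' ha ha')
  rw [← Finset.sum_subset (Finset.subset_univ {a, a'}), Finset.sum_pair haa']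
  · exact h₁ a a' (hadj _ _ haa' ha ha') ha ha'
  · intro c _ hc
    simp only [Finset.mem_insert, Finset.mem_singleton, not_or] at hc
    exact hz c hc.1 hc.2

/-- A decidable certificate that two parts of a set, in cubes whose corners differ in `k`
coordinates, have total mass at most `F / 2 ^ (4 * k)` as soon as the corner sums of their
points add up to at least `t / 30`. -/
abbrev PairBound (k : ℕ) (t : ℤ) (F : ℕ) : Prop :=
  ∀ j ∈ Finset.range (k * 30 + 1), t - 1 - j < k * (30 : ℕ) →
    tailBound k 30 4 j + tailBound k 30 4 (t - 1 - j) ≤ F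

theorem PairBound.add_le {U : Set (EuclideanSpace ℝ (Fin 3))} {d r : ℝ}
    (hU : ∀ x ∈ U, ∀ y ∈ U, dist x y ≤ d) {k : ℕ} {t : ℤ} {F : ℕ} (hF : PairBound k t F)
    (hr : Real.sqrt k ≤ r) (hd : 0 ≤ d) (ht : (t : ℝ) / 30 ≤ 3 * k - 3 * r * d)
    (b b' : Corner) (hk : (differing b b').card = k)
    (hb : cantorMeasure.real (cornerPart U b) ≠ 0)
    (hb' : cantorMeasure.real (cornerPart U b') ≠ 0) :
    cantorMeasure.real (cornerPart U b) + cantorMeasure.real (cornerPart U b') ≤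
      F / 2 ^ (k * 4) := by
  refine cornerPart_measure_add_le (q := 30) (by norm_num) 4 hU hk (t := t) ?_ hF hb hb'
  have := mul_le_mul_of_nonneg_right hr hd
  push_cast
  linarith

theorem differing_comm (b b' : Corner) : differing b b' = differing b' b := by
  ext l; simp [differing, eq_comm]

theorem sqrt_two_le : Real.sqrt (2 : ℕ) ≤ 1.41422 := by
  rw [Real.sqrt_le_left (by norm_num)]; norm_num

theorem sqrt_three_le : Real.sqrt (3 : ℕ) ≤ 1.73206 := by
  rw [Real.sqrt_le_left (by norm_num)]; norm_num

theorem sum_cornerPart_le {U : Set (EuclideanSpace ℝ (Fin 3))} {d hi : ℝ} (hd : 0 ≤ d)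
    (hhi : d ≤ hi) (hU : ∀ x ∈ U, ∀ y ∈ U, dist x y ≤ d) (t₁ t₂ t₃ : ℤ) (F₁ F₂ F₃ g : ℕ) {B : ℝ}
    (c₁ : PairBound 1 t₁ F₁) (c₂ : PairBound 2 t₂ F₂) (c₃ : PairBound 3 t₃ F₃)
    (cg : tailBound 1 30 4 (t₁ - 30) ≤ g)
    (h₁ : (t₁ : ℝ) / 30 ≤ 3 - 3 * hi) (h₂ : (t₂ : ℝ) / 30 ≤ 6 - 3 * 1.41422 * hi)
    (h₃ : (t₃ : ℝ) / 30 ≤ 9 - 3 * 1.73206 * hi)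
    (b1 : (F₁ : ℝ) / 16 ≤ B) (b2 : (F₃ : ℝ) / 4096 ≤ B)
    (b3 : (g : ℝ) / 16 + 3 / 2 * (F₂ / 256) ≤ B) (b4 : (F₃ : ℝ) / 4096 + 3 / 2 * (F₂ / 256) ≤ B)
    (b5 : 3 * ((F₂ : ℝ) / 256) ≤ B) (b6 : 4 * ((F₃ : ℝ) / 4096) ≤ B)
    (b7 : 3 * ((F₃ : ℝ) / 4096) + 1 ≤ B) :
    ∑ b, cantorMeasure.real (cornerPart U b) ≤ B := by
  refine sum_corner_le b1 b2 b3 b4 b5 b6 b7 (by positivity) (by positivity)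
    (fun b => measureReal_le_one) ?_ ?_ ?_
  · intro b b' hk hb hb'
    have hg : ∀ b b', (differing b b').card = 1 → cantorMeasure.real (cornerPart U b') ≠ 0 →
        cantorMeasure.real (cornerPart U b) ≤ g / 16 := by
      intro b b' hk hb'
      refine (cornerPart_measure_le_of_ne_zero (q := 30) (by norm_num) 4 hU hk (t := t₁) ?_
        hb').trans ?_
      · norm_num at *
        linarith
      · norm_num
        gcongr
    refine ⟨?_, hg b b' hk hb', hg b' b (by rwa [differing_comm]) hb⟩
    have := c₁.add_le hU (r := 1) (by norm_num) hd (by norm_num; linarith) b b' hk hb hb'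
    norm_num at this
    exact this
  · intro b b' hk hb hb'
    have := c₂.add_le hU sqrt_two_le hd (by norm_num at *; linarith) b b' hk hb hb'
    norm_num at this
    exact this
  · intro b b' hk hb hb'
    have := c₃.add_le hU sqrt_three_le hd (by norm_num at *; linarith) b b' hk hb hb'
    norm_num at this
    exact this

theorem sum_cornerPart_le_of_antipodal {U : Set (EuclideanSpace ℝ (Fin 3))} {d hi : ℝ}
    (hd : 0 ≤ d) (hhi : d ≤ hi) (hU : ∀ x ∈ U, ∀ y ∈ U, dist x y ≤ d) (t₃ : ℤ) (F₃ : ℕ) {B : ℝ}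
    (c₃ : PairBound 3 t₃ F₃) (h₃ : (t₃ : ℝ) / 30 ≤ 9 - 3 * 1.73206 * hi)
    (b1 : 4 ≤ B) (b2 : 4 * ((F₃ : ℝ) / 4096) ≤ B) :
    ∑ b, cantorMeasure.real (cornerPart U b) ≤ B := by
  refine sum_corner_le_of_antipodal b1 b2 (fun b => measureReal_le_one) ?_
  intro b b' hk hb hb'
  have := c₃.add_le hU sqrt_three_le hd (by norm_num at *; linarith) b b' hk hb hb'
  norm_num at this
  exact this

theorem sum_cornerPart_le_of_adjacent {U : Set (EuclideanSpace ℝ (Fin 3))} {d hi : ℝ}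
    (hd : 0 ≤ d) (hhi : d ≤ hi) (hU : ∀ x ∈ U, ∀ y ∈ U, dist x y ≤ d) (hhi' : hi ≤ 0.46)
    {a a' : Corner} (haa' : a ≠ a') (ha : cantorMeasure.real (cornerPart U a) ≠ 0)
    (ha' : cantorMeasure.real (cornerPart U a') ≠ 0)
    (t₁ : ℤ) (F₁ : ℕ) (c₁ : PairBound 1 t₁ F₁) (h₁ : (t₁ : ℝ) / 30 ≤ 3 - 3 * hi) :
    ∑ b, cantorMeasure.real (cornerPart U b) ≤ F₁ / 16 := by
  refine sum_corner_le_of_adjacent (fun b => measureReal_nonneg) haa' ha ha' ?_ ?_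
  · intro b b' hk hb hb'
    have := c₁.add_le hU (r := 1) (by norm_num) hd (by norm_num; linarith) b b' hk hb hb'
    norm_num at this
    exact this
  · intro b b' hk hb hb'
    have h3 : (differing b b').card ≤ 3 := by simpa using Finset.card_le_univ (differing b b')
    obtain hk | hk : (differing b b').card = 2 ∨ (differing b b').card = 3 := by omega
    -- Two corner sums total at most 120 / 30 (180 / 30 in the next case), so these certificates
    -- hold vacuously: such pairs cannot both be charged.
    · have := (show PairBound 2 121 0 by decide +kernel).add_le hU sqrt_two_le hd
        (by norm_num at *; linarith) b b' hk hb hb'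
      simpa using this
    · have := (show PairBound 3 181 0 by decide +kernel).add_le hU sqrt_three_le hd
        (by norm_num at *; linarith) b b' hk hb hb'
      simpa using this

/-! ### Rational bounds for powers with exponent `cantorExponent 3`. -/

theorem three_rpow_cantorExponent (d : ℕ) : (3 : ℝ) ^ cantorExponent d = 2 ^ d := by
  rw [cantorExponent, mul_comm, Real.rpow_mul (by norm_num),
    Real.rpow_logb (by norm_num) (by norm_num) (by norm_num), Real.rpow_natCast]

theorem logb_three_two_le : Real.logb 3 2 ≤ 53 / 84 := by
  have h : Real.logb 3 ((2 : ℝ) ^ 84) ≤ Real.logb 3 ((3 : ℝ) ^ 53) :=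
    Real.logb_le_logb_of_le (by norm_num) (by norm_num) (by norm_num)
  rw [Real.logb_pow, Real.logb_pow, Real.logb_self_eq_one (by norm_num)] at h
  push_cast at h
  linarith

theorem le_logb_three_two : 17 / 27 ≤ Real.logb 3 2 := by
  have h : Real.logb 3 ((3 : ℝ) ^ 17) ≤ Real.logb 3 ((2 : ℝ) ^ 27) :=
    Real.logb_le_logb_of_le (by norm_num) (by norm_num) (by norm_num)
  rw [Real.logb_pow, Real.logb_pow, Real.logb_self_eq_one (by norm_num)] at h
  push_cast at h
  linarith

theorem cantorExponent_three_pos : 0 < cantorExponent 3 := by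
  have := le_logb_three_two
  rw [cantorExponent]
  push_cast
  linarith

/-- Comparison of a real power with a rational number, reduced to integral exponents. -/
theorem le_rpow_div {x v : ℝ} {m n : ℕ} (hn : n ≠ 0) (hx : 0 ≤ x) (h : v ^ n ≤ x ^ m) :
    v ≤ x ^ ((m : ℝ) / n) := by
  have h1 : (x ^ ((m : ℝ) / n)) ^ n = x ^ m := by
    rw [← Real.rpow_natCast, ← Real.rpow_mul hx, div_mul_cancel₀ _ (by exact_mod_cast hn),
      Real.rpow_natCast]
  rw [← h1] at h
  exact le_of_pow_le_pow_left₀ hn (by positivity) h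

theorem le_rpow_cantorExponent_of_le_one {lo d v : ℝ} (h0 : 0 < lo) (hlo : lo ≤ 1) (hd : lo ≤ d)
    (h : v ^ 28 ≤ lo ^ 53) : v ≤ d ^ cantorExponent 3 := by
  calc v ≤ lo ^ (((53 : ℕ) : ℝ) / (28 : ℕ)) := le_rpow_div (by norm_num) h0.le h
    _ ≤ lo ^ cantorExponent 3 := by
        refine Real.rpow_le_rpow_of_exponent_ge h0 hlo ?_
        have := logb_three_two_le
        rw [cantorExponent]
        push_cast
        linarith
    _ ≤ d ^ cantorExponent 3 := Real.rpow_le_rpow h0.le hd cantorExponent_three_pos.le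

theorem le_rpow_cantorExponent_of_one_le {lo d v : ℝ} (hlo : 1 ≤ lo) (hd : lo ≤ d)
    (h : v ^ 9 ≤ lo ^ 17) : v ≤ d ^ cantorExponent 3 := by
  calc v ≤ lo ^ (((17 : ℕ) : ℝ) / (9 : ℕ)) := le_rpow_div (by norm_num) (by linarith) h
    _ ≤ lo ^ cantorExponent 3 := by
        refine Real.rpow_le_rpow_of_exponent_le hlo ?_
        have := le_logb_three_two
        rw [cantorExponent]
        push_cast
        linarith
    _ ≤ d ^ cantorExponent 3 :=
        Real.rpow_le_rpow (by linarith) hd cantorExponent_three_pos.le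

/-! ### The estimate for sets charging two corner cubes. -/

theorem one_third_le_of_two_parts {U : Set (EuclideanSpace ℝ (Fin 3))} {d : ℝ}
    (hU : ∀ x ∈ U, ∀ y ∈ U, dist x y ≤ d) {b b' : Corner} (hbb' : b ≠ b')
    (hb : (cornerPart U b).Nonempty) (hb' : (cornerPart U b').Nonempty) : 1 / 3 ≤ d := by
  obtain ⟨x, hx⟩ := hb
  obtain ⟨y, hy⟩ := hb'
  obtain ⟨l, hl⟩ := Function.ne_iff.1 hbb'
  have h1 := hU _ hx.1 _ hy.1
  have h2 : |cornerMap b x l - cornerMap b' y l| ≤ dist (cornerMap b x) (cornerMap b' y) := by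
    rw [EuclideanSpace.dist_eq, ← Real.dist_eq]
    refine Real.le_sqrt_of_sq_le ?_
    exact Finset.single_le_sum (f := fun l => dist (cornerMap b x l) (cornerMap b' y l) ^ 2)
      (fun l _ => sq_nonneg _) (Finset.mem_univ l)
  have hx1 := hx.2 l
  have hy1 := hy.2 l
  rw [Set.mem_Icc] at hx1 hy1
  rw [abs_le, cornerMap_apply, cornerMap_apply] at h2
  rcases hb : b l with _ | _ <;> rcases hb' : b' l with _ | _ <;> simp_all <;> linarith

theorem sum_cornerPart_le_rpow {U : Set (EuclideanSpace ℝ (Fin 3))} {d : ℝ}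
    (hU : ∀ x ∈ U, ∀ y ∈ U, dist x y ≤ d) {a a' : Corner} (haa' : a ≠ a')
    (ha : cantorMeasure.real (cornerPart U a) ≠ 0)
    (ha' : cantorMeasure.real (cornerPart U a') ≠ 0) (hd' : d ≤ 1.4) :
    1.812 * ∑ b, cantorMeasure.real (cornerPart U b) ≤ 8 * d ^ cantorExponent 3 := by
  have hne : ∀ c, cantorMeasure.real (cornerPart U c) ≠ 0 → (cornerPart U c).Nonempty := by
    intro c hc
    by_contra h
    rw [Set.not_nonempty_iff_eq_empty] at h
    simp [h] at hc
  have hd3 := one_third_le_of_two_parts hU haa' (hne a ha) (hne a' ha')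
  have hd : 0 ≤ d := by linarith
  suffices h : ∃ B, ∑ b, cantorMeasure.real (cornerPart U b) ≤ B ∧
      1.812 * B / 8 ≤ d ^ cantorExponent 3 by
    obtain ⟨B, h1, h2⟩ := h
    linarith
  -- On each interval the `tₖ` are `30 * (3 * k - 3 * √k * hi)` rounded down, and `B` dominates the
  -- resulting combinations while `1.812 * B / 8` stays below a lower bound for `lo ^ s` at the left
  -- end `lo`.
  rcases le_total d 0.42 with h | h42
  · exact ⟨_, sum_cornerPart_le_of_adjacent hd h hU (by norm_num) haa' ha ha' 52 8
      (by decide +kernel) (by norm_num), le_rpow_cantorExponent_of_le_one (by norm_num)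
      (by norm_num) hd3 (by norm_num)⟩
  rcases le_total d 0.46 with h | h46
  · exact ⟨_, sum_cornerPart_le_of_adjacent hd h hU (by norm_num) haa' ha ha' 48 12
      (by decide +kernel) (by norm_num), le_rpow_cantorExponent_of_le_one (by norm_num)
      (by norm_num) h42 (by norm_num)⟩
  rcases le_total d 0.57 with h | h57
  · exact ⟨1, sum_cornerPart_le hd h hU 38 107 181 16 51 0 10 (by decide +kernel)
      (by decide +kernel) (by decide +kernel) (by decide +kernel) (by norm_num) (by norm_num)
      (by norm_num) (by norm_num) (by norm_num) (by norm_num) (by norm_num) (by norm_num)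
      (by norm_num) (by norm_num), le_rpow_cantorExponent_of_le_one (by norm_num)
      (by norm_num) h46 (by norm_num)⟩
  rcases le_total d 0.65 with h | h65
  · exact ⟨1.477, sum_cornerPart_le hd h hU 31 97 168 17 92 224 15 (by decide +kernel)
      (by decide +kernel) (by decide +kernel) (by decide +kernel) (by norm_num) (by norm_num)
      (by norm_num) (by norm_num) (by norm_num) (by norm_num) (by norm_num) (by norm_num)
      (by norm_num) (by norm_num), le_rpow_cantorExponent_of_le_one (by norm_num)
      (by norm_num) h57 (by norm_num)⟩
  rcases le_total d 0.72 with h | h72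
  · exact ⟨1.944, sum_cornerPart_le hd h hU 25 88 157 20 161 565 16 (by decide +kernel)
      (by decide +kernel) (by decide +kernel) (by decide +kernel) (by norm_num) (by norm_num)
      (by norm_num) (by norm_num) (by norm_num) (by norm_num) (by norm_num) (by norm_num)
      (by norm_num) (by norm_num), le_rpow_cantorExponent_of_le_one (by norm_num)
      (by norm_num) h65 (by norm_num)⟩
  rcases le_total d 0.79 with h | h79
  · exact ⟨2.344, sum_cornerPart_le hd h hU 18 79 146 24 200 1335 16 (by decide +kernel)
      (by decide +kernel) (by decide +kernel) (by decide +kernel) (by norm_num) (by norm_num)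
      (by norm_num) (by norm_num) (by norm_num) (by norm_num) (by norm_num) (by norm_num)
      (by norm_num) (by norm_num), le_rpow_cantorExponent_of_le_one (by norm_num)
      (by norm_num) h72 (by norm_num)⟩
  rcases le_total d 0.87 with h | h87
  · exact ⟨2.801, sum_cornerPart_le hd h hU 11 69 134 25 239 2208 16 (by decide +kernel)
      (by decide +kernel) (by decide +kernel) (by decide +kernel) (by norm_num) (by norm_num)
      (by norm_num) (by norm_num) (by norm_num) (by norm_num) (by norm_num) (by norm_num)
      (by norm_num) (by norm_num), le_rpow_cantorExponent_of_le_one (by norm_num)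
      (by norm_num) h79 (by norm_num)⟩
  rcases le_total d 0.94 with h | h94
  · exact ⟨3.294, sum_cornerPart_le hd h hU 5 60 123 28 280 3132 16 (by decide +kernel)
      (by decide +kernel) (by decide +kernel) (by decide +kernel) (by norm_num) (by norm_num)
      (by norm_num) (by norm_num) (by norm_num) (by norm_num) (by norm_num) (by norm_num)
      (by norm_num) (by norm_num), le_rpow_cantorExponent_of_le_one (by norm_num)
      (by norm_num) h87 (by norm_num)⟩
  rcases le_total d 0.99 with h | h99
  · exact ⟨3.844, sum_cornerPart_le hd h hU 0 53 115 32 328 3605 16 (by decide +kernel)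
      (by decide +kernel) (by decide +kernel) (by decide +kernel) (by norm_num) (by norm_num)
      (by norm_num) (by norm_num) (by norm_num) (by norm_num) (by norm_num) (by norm_num)
      (by norm_num) (by norm_num), le_rpow_cantorExponent_of_le_one (by norm_num)
      (by norm_num) h94 (by norm_num)⟩
  -- From here on the bounds along the long diagonals alone suffice.
  rcases le_total d 1.15 with h | h115
  · exact ⟨4.211, sum_cornerPart_le_of_antipodal hd h hU 90 4312 (by decide +kernel)
      (by norm_num) (by norm_num) (by norm_num), le_rpow_cantorExponent_of_le_one (by norm_num)
      (by norm_num) h99 (by norm_num)⟩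
  rcases le_total d 1.28 with h | h128
  · exact ⟨5.711, sum_cornerPart_le_of_antipodal hd h hU 70 5848 (by decide +kernel)
      (by norm_num) (by norm_num) (by norm_num), le_rpow_cantorExponent_of_one_le
      (by norm_num) h115 (by norm_num)⟩
  · exact ⟨6.946, sum_cornerPart_le_of_antipodal hd hd' hU 51 7112 (by decide +kernel)
      (by norm_num) (by norm_num) (by norm_num), le_rpow_cantorExponent_of_one_le
      (by norm_num) h128 (by norm_num)⟩

/-! ### Rescaling and the mass distribution principle. -/

theorem dist_cornerMap (b : Corner) (x y : EuclideanSpace ℝ (Fin 3)) :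
    dist (cornerMap b x) (cornerMap b y) = dist x y / 3 := by
  have : cornerMap b x - cornerMap b y = (3 : ℝ)⁻¹ • (x - y) := by
    ext l
    simp only [PiLp.sub_apply, cornerMap_apply, PiLp.smul_apply, smul_eq_mul]
    ring
  rw [dist_eq_norm, this, norm_smul, dist_eq_norm]
  norm_num
  ring

/-- `n` bounds the number of enlargements by 3 before the diameter bound reaches 1.4. If only one
corner cube is charged, the factor 1/8 cancels `3 ^ s = 8`. -/
theorem cantorMeasure_le_rpow (n : ℕ) : ∀ {U : Set (EuclideanSpace ℝ (Fin 3))} {d : ℝ},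
    IsClosed U → 0 < d → (∀ x ∈ U, ∀ y ∈ U, dist x y ≤ d) → 1.4 ≤ 3 ^ n * d →
    1.812 * cantorMeasure.real U ≤ d ^ cantorExponent 3 := by
  induction n with
  | zero =>
    intro U d _ _ _ hn
    have h1 : cantorMeasure.real U ≤ 1 := measureReal_le_one
    have h2 : (1.812 : ℝ) ≤ d ^ cantorExponent 3 :=
      le_rpow_cantorExponent_of_one_le (lo := 1.4) (by norm_num) (by simpa using hn) (by norm_num)
    linarith
  | succ n ih =>
    intro U d hUc hd hU hn
    rcases le_total 1.4 d with h14 | h14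
    · have h1 : cantorMeasure.real U ≤ 1 := measureReal_le_one
      have h2 : (1.812 : ℝ) ≤ d ^ cantorExponent 3 :=
        le_rpow_cantorExponent_of_one_le (by norm_num) h14 (by norm_num)
      linarith
    rw [cantorMeasure_real_eq_sum_cornerPart hUc.measurableSet]
    suffices 1.812 * ∑ b, cantorMeasure.real (cornerPart U b) ≤ 8 * d ^ cantorExponent 3 by
      linarith
    by_cases h : ∃ a a', a ≠ a' ∧ cantorMeasure.real (cornerPart U a) ≠ 0 ∧
        cantorMeasure.real (cornerPart U a') ≠ 0
    · obtain ⟨a, a', haa', ha, ha'⟩ := h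
      exact sum_cornerPart_le_rpow hU haa' ha ha' h14
    · push Not at h
      obtain ⟨a, ha⟩ : ∃ a, ∀ b, b ≠ a → cantorMeasure.real (cornerPart U b) = 0 := by
        by_cases h0 : ∃ a, cantorMeasure.real (cornerPart U a) ≠ 0
        · obtain ⟨a, ha⟩ := h0
          exact ⟨a, fun b hb => h a b hb.symm ha⟩
        · push Not at h0
          exact ⟨fun _ => false, fun b _ => h0 b⟩
      rw [Finset.sum_eq_single a (fun b _ hb => ha b hb) (by simp)]
      have h1 := ih (U := cornerMap a ⁻¹' U) (d := 3 * d) (hUc.preimage (continuous_cornerMap a))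
        (by positivity) (fun x hx y hy => by
          have := hU _ hx _ hy
          rw [dist_cornerMap] at this
          linarith) (by rw [pow_succ] at hn; linarith)
      rw [Real.mul_rpow (by norm_num) hd.le, three_rpow_cantorExponent] at h1
      have h2 : cantorMeasure.real (cornerPart U a) = cantorMeasure.real (cornerMap a ⁻¹' U) := by
        rw [cornerPart, measureReal_def, cantorMeasure_inter_unitCube, measureReal_def]
      rw [h2]
      norm_num at h1 ⊢
      exact h1

theorem cantorMeasure_le_diam_rpow {U : Set (EuclideanSpace ℝ (Fin 3))}
    (hU : Bornology.IsBounded U) :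
    1.812 * cantorMeasure.real U ≤ Metric.diam U ^ cantorExponent 3 := by
  have h1 : ∀ d > Metric.diam U, 1.812 * cantorMeasure.real U ≤ d ^ cantorExponent 3 := by
    intro d hd
    have hd0 : 0 < d := Metric.diam_nonneg.trans_lt hd
    obtain ⟨n, hn⟩ := pow_unbounded_of_one_lt (1.4 / d) (by norm_num : (1 : ℝ) < 3)
    rw [div_lt_iff₀ hd0] at hn
    refine le_trans ?_ (cantorMeasure_le_rpow n (U := closure U) isClosed_closure hd0 ?_ hn.le)
    · gcongr
      · exact measure_ne_top _ _
      · exact subset_closure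
    · intro x hx y hy
      rw [← Metric.diam_closure] at hd
      exact (Metric.dist_le_diam_of_mem hU.closure hx hy).trans hd.le
  -- Letting `d` decrease to the diameter also covers diameter zero.
  have h2 : ContinuousAt (fun d : ℝ => d ^ cantorExponent 3) (Metric.diam U) :=
    Real.continuousAt_rpow_const _ _ (Or.inr cantorExponent_three_pos.le)
  exact ge_of_tendsto (h2.tendsto.mono_left nhdsWithin_le_nhds)
    (Filter.eventually_of_mem self_mem_nhdsWithin h1 : ∀ᶠ d in nhdsWithin _ (Set.Ioi _), _)

theorem le_hausdorffMeasure_cantorProduct_three :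
    ENNReal.ofReal 1.812 ≤ Measure.hausdorffMeasure (cantorExponent 3) (cantorProduct 3) := by
  have h : ENNReal.ofReal 1.812 • cantorMeasure ≤ Measure.hausdorffMeasure (cantorExponent 3) := by
    refine Measure.le_hausdorffMeasure _ _ 1 one_pos fun U hU => ?_
    have hb : Bornology.IsBounded U := by
      rw [Metric.isBounded_iff_ediam_ne_top]
      exact (hU.trans_lt ENNReal.one_lt_top).ne
    have h1 := ENNReal.ofReal_le_ofReal (cantorMeasure_le_diam_rpow hb)
    rw [ENNReal.ofReal_mul (by norm_num), ofReal_measureReal (measure_ne_top _ _),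
      ← ENNReal.ofReal_rpow_of_nonneg Metric.diam_nonneg cantorExponent_three_pos.le,
      Metric.diam, ENNReal.ofReal_toReal (Metric.isBounded_iff_ediam_ne_top.1 hb)] at h1
    exact h1
  simpa [cantorMeasure_cantorProduct] using h (cantorProduct 3)

/-! ### The upper bound for the planar product. -/

/-- The similarity of ratio `1 / 3` which maps the unit square to the square at the corner `b`. -/
noncomputable def planarCornerMap (b : Fin 2 → Bool) (x : EuclideanSpace ℝ (Fin 2)) :
    EuclideanSpace ℝ (Fin 2) :=
  WithLp.toLp 2 fun l => ((if b l then 2 else 0) + x l) / 3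

theorem dist_planarCornerMap (b : Fin 2 → Bool) (x y : EuclideanSpace ℝ (Fin 2)) :
    dist (planarCornerMap b x) (planarCornerMap b y) = dist x y / 3 := by
  have : planarCornerMap b x - planarCornerMap b y = (3 : ℝ)⁻¹ • (x - y) := by
    ext l
    simp only [PiLp.sub_apply, planarCornerMap, PiLp.smul_apply, smul_eq_mul]
    ring
  rw [dist_eq_norm, this, norm_smul, dist_eq_norm]
  norm_num
  ring

/-- The pieces of the `n`-th generation of the square of the Cantor set. -/
noncomputable def planarPiece : (n : ℕ) → (Fin n → Fin 2 → Bool) → Set (EuclideanSpace ℝ (Fin 2))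
  | 0, _ => cantorProduct 2
  | n + 1, w => planarCornerMap (w 0) '' planarPiece n (Fin.tail w)

theorem cantorProduct_two_subset (n : ℕ) : cantorProduct 2 ⊆ ⋃ w, planarPiece n w := by
  induction n with
  | zero => exact fun x hx => Set.mem_iUnion.2 ⟨Fin.elim0, hx⟩
  | succ n ih =>
    intro x hx
    have h1 : ∀ l, ∃ b : Bool, ∃ y ∈ cantorSet, x l = ((if b then 2 else 0) + y) / 3 := by
      intro l
      have := hx l
      rw [cantorSet_eq_union_halves] at this
      rcases this with ⟨y, hy, h⟩ | ⟨y, hy, h⟩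
      · exact ⟨false, y, hy, by simp [← h]⟩
      · exact ⟨true, y, hy, by simp [← h]⟩
    choose b y hy hxy using h1
    obtain ⟨w, hw⟩ := Set.mem_iUnion.1 (ih (show WithLp.toLp 2 y ∈ cantorProduct 2 from hy))
    refine Set.mem_iUnion.2 ⟨Fin.cons b w, ?_⟩
    rw [planarPiece, Fin.cons_zero, Fin.tail_cons]
    refine ⟨_, hw, ?_⟩
    ext l
    simp [planarCornerMap, hxy]

theorem dist_le_of_mem_planarPiece (n : ℕ) : ∀ (w : Fin n → Fin 2 → Bool),
    ∀ x ∈ planarPiece n w, ∀ y ∈ planarPiece n w, dist x y ≤ Real.sqrt 2 / 3 ^ n := by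
  induction n with
  | zero =>
    intro w x hx y hy
    rw [EuclideanSpace.dist_eq, pow_zero, div_one]
    refine Real.sqrt_le_sqrt ?_
    rw [Fin.sum_univ_two]
    have h : ∀ l, dist (x l) (y l) ^ 2 ≤ 1 := by
      intro l
      have h1 := cantorSet_subset_unitInterval (hx l)
      have h2 := cantorSet_subset_unitInterval (hy l)
      exact pow_le_one₀ dist_nonneg (by simpa using Real.dist_le_of_mem_Icc h1 h2)
    linarith [h 0, h 1]
  | succ n ih =>
    rintro w _ ⟨x, hx, rfl⟩ _ ⟨y, hy, rfl⟩
    rw [dist_planarCornerMap, pow_succ, ← div_div]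
    gcongr
    exact ih _ x hx y hy

theorem hausdorffMeasure_cantorProduct_two_le :
    Measure.hausdorffMeasure (cantorExponent 2) (cantorProduct 2) ≤
      ENNReal.ofReal (2 ^ Real.logb 3 2) := by
  have hs : 0 ≤ cantorExponent 2 := by
    have := le_logb_three_two
    rw [cantorExponent]
    push_cast
    linarith
  have hdiam : ∀ n (w : Fin n → Fin 2 → Bool),
      Metric.ediam (planarPiece n w) ≤ ENNReal.ofReal (Real.sqrt 2 / 3 ^ n) := by
    intro n w
    refine Metric.ediam_le fun x hx y hy => ?_
    rw [edist_dist]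
    exact ENNReal.ofReal_le_ofReal (dist_le_of_mem_planarPiece n w x hx y hy)
  have hlim : Filter.Tendsto (fun n : ℕ => ENNReal.ofReal (Real.sqrt 2 / 3 ^ n)) Filter.atTop
      (nhds 0) := by
    rw [← ENNReal.ofReal_zero]
    refine ENNReal.tendsto_ofReal ?_
    exact tendsto_const_nhds.div_atTop (tendsto_pow_atTop_atTop_of_one_lt (by norm_num))
  refine (Measure.hausdorffMeasure_le_liminf_sum (cantorExponent 2) (cantorProduct 2) _ hlim
    planarPiece (.of_forall hdiam) (.of_forall cantorProduct_two_subset)).trans ?_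
  -- There are `4 ^ n` pieces and `3 ^ cantorExponent 2 = 4`, so the bound does not depend on `n`.
  have hsum : ∀ n, ∑ w, Metric.ediam (planarPiece n w) ^ cantorExponent 2 ≤
      ENNReal.ofReal (2 ^ Real.logb 3 2) := by
    intro n
    calc ∑ w, Metric.ediam (planarPiece n w) ^ cantorExponent 2
        ≤ ∑ w : Fin n → Fin 2 → Bool,
            ENNReal.ofReal ((Real.sqrt 2 / 3 ^ n) ^ cantorExponent 2) := by
          refine Finset.sum_le_sum fun w _ => ?_
          rw [← ENNReal.ofReal_rpow_of_nonneg (by positivity) hs]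
          exact ENNReal.rpow_le_rpow (hdiam n w) hs
      _ = ENNReal.ofReal (2 ^ Real.logb 3 2) := by
          have h1 : ((3 : ℝ) ^ n) ^ cantorExponent 2 = 4 ^ n := by
            rw [← Real.rpow_natCast, ← Real.rpow_mul (by norm_num), mul_comm,
              Real.rpow_mul (by norm_num), three_rpow_cantorExponent, Real.rpow_natCast]
            norm_num
          have h2 : Real.sqrt 2 ^ cantorExponent 2 = 2 ^ Real.logb 3 2 := by
            rw [cantorExponent, Real.rpow_mul (by positivity), Nat.cast_ofNat, Real.rpow_ofNat,
              Real.sq_sqrt (by norm_num)]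
          rw [Real.div_rpow (by positivity) (by positivity), h1, h2, Finset.sum_const,
            nsmul_eq_mul, ← ENNReal.ofReal_natCast, ← ENNReal.ofReal_mul (by positivity)]
          congr 1
          have h3 : (Finset.univ : Finset (Fin n → Fin 2 → Bool)).card = 4 ^ n := by simp
          rw [h3]
          push_cast
          field_simp
  exact (Filter.liminf_le_liminf (.of_forall hsum)).trans (by simp)

/-! ### Numerical comparisons. -/

theorem two_rpow_logb_le : (2 : ℝ) ^ Real.logb 3 2 ≤ 1.6 := by
  calc (2 : ℝ) ^ Real.logb 3 2 ≤ 2 ^ (2 / 3 : ℝ) := by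
        refine Real.rpow_le_rpow_of_exponent_le (by norm_num) ?_
        have := logb_three_two_le
        linarith
    _ ≤ 1.6 := by
        have h : ((2 : ℝ) ^ (2 / 3 : ℝ)) ^ 3 = 4 := by
          rw [← Real.rpow_natCast, ← Real.rpow_mul (by norm_num)]
          norm_num
        refine le_of_pow_le_pow_left₀ (n := 3) (by norm_num) (by norm_num) ?_
        rw [h]
        norm_num

theorem sq_closedForm_base : (2 * Real.sqrt 26 / 9) ^ 2 = (104 / 81 : ℝ) := by
  rw [div_pow, mul_pow, Real.sq_sqrt (by norm_num)]
  norm_num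

/-- The decimal 1.266862 is so close to the closed form that 17 / 27 would be too coarse. -/
theorem rational_le_logb_three_two : 971 / 1539 ≤ Real.logb 3 2 := by
  have h : Real.logb 3 ((3 : ℝ) ^ 971) ≤ Real.logb 3 ((2 : ℝ) ^ 1539) :=
    Real.logb_le_logb_of_le (by norm_num) (by positivity)
      (by exact_mod_cast (by decide +kernel : (3 : ℕ) ^ 971 ≤ 2 ^ 1539))
  rw [Real.logb_pow, Real.logb_pow, Real.logb_self_eq_one (by norm_num)] at h
  push_cast at h
  linarith

theorem one_le_closedForm_base : 1 ≤ 2 * Real.sqrt 26 / 9 := by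
  refine le_of_pow_le_pow_left₀ (n := 2) (by norm_num) (by positivity) ?_
  rw [sq_closedForm_base]
  norm_num

theorem le_closedForm : (1.266862 : ℝ) ≤ (2 * Real.sqrt 26 / 9) ^ (3 * Real.logb 3 2) := by
  -- The exponent is `3 * 971 / 1539`, with numerator and denominator doubled so that the square
  -- root disappears.
  calc (1.266862 : ℝ) ≤ (2 * Real.sqrt 26 / 9) ^ (((2 * 2913 : ℕ) : ℝ) / (3078 : ℕ)) := by
        refine le_rpow_div (by norm_num) (by positivity) ?_
        have h : (1266862 : ℝ) ^ 3078 * 81 ^ 2913 ≤ 104 ^ 2913 * (10 ^ 6) ^ 3078 := by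
          exact_mod_cast (by decide +kernel :
            (1266862 : ℕ) ^ 3078 * 81 ^ 2913 ≤ 104 ^ 2913 * (10 ^ 6) ^ 3078)
        rw [pow_mul, sq_closedForm_base, div_pow, le_div_iff₀ (by positivity),
          show (1.266862 : ℝ) = 1266862 / 10 ^ 6 by norm_num, div_pow, div_mul_eq_mul_div,
          div_le_iff₀ (by positivity)]
        exact h
    _ ≤ _ := by
        refine Real.rpow_le_rpow_of_exponent_le one_le_closedForm_base ?_
        have := rational_le_logb_three_two
        push_cast
        linarith

theorem closedForm_le : (2 * Real.sqrt 26 / 9) ^ (3 * Real.logb 3 2) ≤ 1.3 := by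
  calc (2 * Real.sqrt 26 / 9) ^ (3 * Real.logb 3 2) ≤ (2 * Real.sqrt 26 / 9) ^ (2 : ℝ) := by
        refine Real.rpow_le_rpow_of_exponent_le one_le_closedForm_base ?_
        have := logb_three_two_le
        linarith
    _ ≤ 1.3 := by
        rw [Real.rpow_ofNat, sq_closedForm_base]
        norm_num

theorem mainTheorem1 :
    -- the lower bound
    ENNReal.ofReal ((2 * Real.sqrt 26 / 9) ^ (3 * Real.logb 3 2)) <
        MeasureTheory.Measure.hausdorffMeasure (cantorExponent 3) (cantorProduct 3) ∧
    -- numerical value of the closed form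
    (1.266862 : ℝ) ≤ (2 * Real.sqrt 26 / 9) ^ (3 * Real.logb 3 2) ∧
    -- the decimal lower bound on the measure
    ENNReal.ofReal 1.811621 <
        MeasureTheory.Measure.hausdorffMeasure (cantorExponent 3) (cantorProduct 3) ∧
    -- comparison with the planar product
    MeasureTheory.Measure.hausdorffMeasure (cantorExponent 2) (cantorProduct 2) <
        MeasureTheory.Measure.hausdorffMeasure (cantorExponent 3) (cantorProduct 3) := by
  have h : ∀ {r : ℝ}, r < 1.812 → ENNReal.ofReal r <
      Measure.hausdorffMeasure (cantorExponent 3) (cantorProduct 3) := fun hr =>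
    ((ENNReal.ofReal_lt_ofReal_iff (by norm_num)).2 hr).trans_le
      le_hausdorffMeasure_cantorProduct_three
  refine ⟨h ?_, le_closedForm, h (by norm_num), hausdorffMeasure_cantorProduct_two_le.trans_lt
    (h ?_)⟩
  · linarith [closedForm_le]
  · linarith [two_rpow_logb_le]
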